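/- **Parameters.** Let $\mathbf N$ be the set of tuples $\mathbf n=(T,\mathrm{nor},\bar\lambda,\bar\mu)$ such that: - (a) $T$ is a subtree of $\omega^{<\omega}$ (a nonempty set of finite sequences closed under initial segments); write $\mathrm{suc}_T(\eta)=\{\eta^\frown m: \eta^\frown m\in T\}$ and $\lg(\eta)$ for the length of $\eta$. - (b) $\bar\mu=(\mu_\eta:\eta\in T)$ is a sequence of non-negative reals. - (c) $\bar\lambda=(\lambda_\eta:\eta\in T)$ is a sequence of pairwise distinct non-zero natural numbers with $\lambda_\eta=\{m:\eta^\frown m\in T\}$ (so the immediate successors of $\eta$ are the $\eta^\frown m$ with $m<\lambda_\eta$), and: if $\lg(\eta)=\lg(\nu)$ and $\eta<_{lex}\nu$ then $\lambda_\eta<\lambda_\nu$; if $\lg(\eta)<\lg(\nu)$ then $\lg(\eta)<\lambda_\eta<\lambda_\nu$; and $\lg(\eta)<\mu_\eta<\lambda_\eta$ for all $\eta\in T$. - (d) For $\eta\in T$, $\mathrm{nor}_\eta$ assigns to each nonempty $X\subseteq\mathrm{suc}_T(\eta)$ a non-negative real, monotonically in $X$, and $(\lg(\eta)+1)^2\le\mu_\eta\le\mathrm{nor}_\eta(\mathrm{suc}_T(\eta))$.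 - (e) $\prod\{\lambda_\nu:\nu\in T,\ \lambda_\nu<\lambda_\eta\}<\mu_\eta$ for $\eta\in T$. - (f) (Co-bigness) If $k>0$ is real, $1\le i_*\le\mu_\eta$ is an integer, and $a_i\subseteq\mathrm{suc}_T(\eta)$ is nonempty with $k+\frac1{\mu_\eta}\le\mathrm{nor}_\eta(a_i)$ for every $i<i_*$, then $\bigcap_{i<i_*}a_i\neq\emptyset$ and $k\le\mathrm{nor}_\eta(\bigcap_{i<i_*}a_i)$. - (g) If $\emptyset\ne a\subseteq\mathrm{suc}_T(\eta)$ and $1\le\mathrm{nor}_\eta(a)$, then $\frac12<|a|/|\mathrm{suc}_T(\eta)|$. - (h) If $k>0$ is real, $a\subseteq\mathrm{suc}_T(\eta)$, $\rho\in a$ and $k+\mu_\eta\le\mathrm{nor}_\eta(a)$, then $a\setminus\{\rho\}\ne\emptyset$ and $k\le\mathrm{nor}_\eta(a\setminus\{\rho\})$. **The forcing.** For $\mathbf n\in\mathbf N$, a condition $p\in\mathbb Q^2_{\mathbf n}$ consists of a trunk $\mathrm{tr}(p)\in T$, a perfect subtree $T_p\subseteq T$ that contains $\mathrm{tr}(p)$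 and all of whose nodes are comparable with $\mathrm{tr}(p)$, and a natural number $n\in[1,\lg(\mathrm{tr}(p))+1]$ such that $1+\frac1n\le\mathrm{nor}_\eta(\mathrm{suc}_{T_p}(\eta))$ for every $\eta\in T_p$ extending or equal to $\mathrm{tr}(p)$. A condition $q$ is stronger than $p$ iff $T_q\subseteq T_p$. **Claim.** For every $\mathbf n\in\mathbf N$, the forcing $\mathbb Q^2_{\mathbf n}$ does not add a dominating real: there are no condition $p$ and no $\mathbb Q^2_{\mathbf n}$-name $g$ such that $p$ forces that $g\in\omega^\omega$ and that, for every $f\in\omega^\omega$ in the ground model, $f(n)\le g(n)$ for all but finitely many $n$. -/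

import Mathlib

/-! ### Trees of finite sequences of natural numbers

Finite sequences are lists; `η <+: ν` says that `η` is an initial segment of `ν`, and
`η ++ [m]` is `η` followed by `m`. -/

/-- A subtree of `ω^{<ω}`: a nonempty set of finite sequences closed under initial segments. -/
def IsSubtree (T : Set (List ℕ)) : Prop :=
  T.Nonempty ∧ ∀ η ν : List ℕ, η <+: ν → ν ∈ T → η ∈ T

/-- The set of immediate successors of `η` in `T`. -/
def treeSuc (T : Set (List ℕ)) (η : List ℕ) : Set (List ℕ) :=
  {ν | ν ∈ T ∧ ∃ m : ℕ, ν = η ++ [m]}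

/-- A perfect tree: a subtree of `ω^{<ω}` in which every node has two incomparable extensions. -/
def IsPerfectTree (T : Set (List ℕ)) : Prop :=
  IsSubtree T ∧ ∀ η ∈ T, ∃ ν₁ ∈ T, ∃ ν₂ ∈ T,
    η <+: ν₁ ∧ η <+: ν₂ ∧ ¬ ν₁ <+: ν₂ ∧ ¬ ν₂ <+: ν₁

/-- The subtree of the nodes of `T` that are comparable with `η`. -/
def treeAbove (T : Set (List ℕ)) (η : List ℕ) : Set (List ℕ) :=
  {ν | ν ∈ T ∧ (ν <+: η ∨ η <+: ν)}

/-! ### The parameters -/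

/-- The parameters `𝐧 = (T, nor, λ, μ)`. The functions `nor`, `lam`, `mu` matter only at nodes
of `T`, and `nor η` only at nonempty subsets of `treeSuc T η`; an inequality `k ≤ nor η a`
in a conclusion includes that `a` is nonempty. The relation "much smaller" is only required to
mean "smaller", so that the parameters for every stricter reading of it are among these. -/
structure CreatureParam where
  T : Set (List ℕ)
  nor : List ℕ → Set (List ℕ) → ℝ
  lam : List ℕ → ℕ
  mu : List ℕ → ℝ
  subtree : IsSubtree T
  mu_nonneg : ∀ η ∈ T, 0 ≤ mu η
  lam_injOn : Set.InjOn lam T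
  lam_ne_zero : ∀ η ∈ T, lam η ≠ 0
  /-- `λ_η = {m : η ⌢ m ∈ T}`, where a natural number is the set of the smaller ones. -/
  lam_spec : ∀ η ∈ T, ∀ m : ℕ, η ++ [m] ∈ T ↔ m < lam η
  lam_lex : ∀ η ∈ T, ∀ ν ∈ T, η.length = ν.length → List.Lex (· < ·) η ν → lam η < lam ν
  lam_length : ∀ η ∈ T, ∀ ν ∈ T, η.length < ν.length → η.length < lam η ∧ lam η < lam ν
  length_lt_mu : ∀ η ∈ T, (η.length : ℝ) < mu η
  mu_lt_lam : ∀ η ∈ T, mu η < (lam η : ℝ)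
  nor_nonneg : ∀ η ∈ T, ∀ a ⊆ treeSuc T η, a.Nonempty → 0 ≤ nor η a
  nor_mono : ∀ η ∈ T, ∀ a b : Set (List ℕ), a ⊆ b → b ⊆ treeSuc T η → a.Nonempty →
    nor η a ≤ nor η b
  sq_le_mu : ∀ η ∈ T, ((η.length : ℝ) + 1) ^ 2 ≤ mu η
  mu_le_nor : ∀ η ∈ T, mu η ≤ nor η (treeSuc T η)
  /-- The product is over a finite set, because `lam` is injective on `T`. -/
  prod_lt_mu : ∀ η ∈ T, (∏ᶠ ν ∈ {ν | ν ∈ T ∧ lam ν < lam η}, (lam ν : ℝ)) < mu η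
  /-- Co-bigness. -/
  co_big : ∀ η ∈ T, ∀ k : ℝ, 0 < k → ∀ i : ℕ, 0 < i → (i : ℝ) ≤ mu η →
    ∀ a : Fin i → Set (List ℕ),
      (∀ j, a j ⊆ treeSuc T η ∧ (a j).Nonempty ∧ k + 1 / mu η ≤ nor η (a j)) →
      (⋂ j, a j).Nonempty ∧ k ≤ nor η (⋂ j, a j)
  half_lt : ∀ η ∈ T, ∀ a ⊆ treeSuc T η, a.Nonempty → 1 ≤ nor η a →
    (1 : ℝ) / 2 < (a.ncard : ℝ) / ((treeSuc T η).ncard : ℝ)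
  nor_diff : ∀ η ∈ T, ∀ k : ℝ, 0 < k → ∀ a ⊆ treeSuc T η, ∀ ρ ∈ a, k + mu η ≤ nor η a →
    (a \ {ρ}).Nonempty ∧ k ≤ nor η (a \ {ρ})

/-! ### The forcing notion -/

/-- The conditions of the forcing notion `ℚ²_𝐧`. -/
structure QTwo (c : CreatureParam) where
  trunk : List ℕ
  tree : Set (List ℕ)
  n : ℕ
  trunk_mem : trunk ∈ tree
  perfect : IsPerfectTree tree
  tree_subset : tree ⊆ treeAbove c.T trunk
  one_le : 1 ≤ n
  n_le : n ≤ trunk.length + 1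
  le_nor : ∀ η ∈ tree, trunk <+: η → (treeSuc tree η).Nonempty ∧
    1 + 1 / (n : ℝ) ≤ c.nor η (treeSuc tree η)

/-- Reverse inclusion of trees: `p ≤ q` says that `q` is the stronger condition. -/
instance (c : CreatureParam) : Preorder (QTwo c) where
  le p q := q.tree ⊆ p.tree
  le_refl p := Set.Subset.refl p.tree
  le_trans _ _ _ h₁ h₂ := Set.Subset.trans h₂ h₁

/-! ### Names of reals and the forcing relation

Throughout, `p ≤ q` means that `q` is stronger than `p`. A sentence of the forcing language is
represented by the set of the conditions that force it, and the logical operations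
are the usual recursive clauses of the forcing relation. -/

namespace Forcing

variable {P : Type*} [Preorder P]

/-- `p ⊩ ∀ x, φ x`, where `x` ranges over a set of the ground model. -/
def all {X : Type*} (φ : X → P → Prop) (p : P) : Prop := ∀ x, φ x p

/-- `p ⊩ ∃ x, φ x`, where `x` ranges over a set of the ground model: the conditions that force
some `φ x` are dense above `p`. -/
def ex {X : Type*} (φ : X → P → Prop) (p : P) : Prop :=
  ∀ q, p ≤ q → ∃ r, q ≤ r ∧ ∃ x, φ x r

/-- `p ⊩ φ ∧ ψ`. -/
def and (φ ψ : P → Prop) (p : P) : Prop := φ p ∧ ψ p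

/-- `p ⊩ φ → ψ`. -/
def imp (φ ψ : P → Prop) (p : P) : Prop := ∀ q, p ≤ q → φ q → ψ q

/-- `p ⊩ A`, where `A` is a statement about elements of the ground model. -/
def ground (A : Prop) (_ : P) : Prop := A

/-- `P`-names of subsets of `ω × ω`: sets of pairs `((n, m), s)`, where `(n, m)` stands for its
canonical name and `s` is a condition. Every subset of `ω × ω` in a generic extension has
such a name. -/
abbrev Name (P : Type*) := Set ((ℕ × ℕ) × P)

/-- `p ⊩ (n, m) ∈ g`. -/
def mem (g : Name P) (n m : ℕ) (p : P) : Prop :=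
  ∀ q, p ≤ q → ∃ r, q ≤ r ∧ ∃ s, ((n, m), s) ∈ g ∧ s ≤ r

/-- `p ⊩ g ∈ ω^ω`. -/
def isReal (g : Name P) : P → Prop :=
  and (all fun n => ex fun m => mem g n m)
    (all fun n => all fun m => all fun m' =>
      imp (and (mem g n m) (mem g n m')) (ground (m = m')))

/-- `p ⊩ f ≤* g`, for `f ∈ ω^ω` in the ground model: `f n ≤ g n` for all but finitely many
`n`. -/
def dominates (g : Name P) (f : ℕ → ℕ) : P → Prop :=
  ex fun N : ℕ => all fun n : ℕ => all fun m : ℕ =>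
    imp (and (ground (N ≤ n)) (mem g n m)) (ground (f n ≤ m))

/-- Some condition forces that some real of the extension dominates every real of the
ground model. -/
def AddsDominatingReal (P : Type*) [Preorder P] : Prop :=
  ∃ (p : P) (g : Name P), isReal g p ∧ all (fun f : ℕ → ℕ => dominates g f) p

end Forcing

/-! The reason is compactness combined with countability. There are only countably many pairs
(trunk, norm bound). Since `c.T` is finitely branching, conditions `q m` sharing such a pair have an
ultrafilter limit with the same pair (`QTwo.exists_ultralimit`).

Suppose each `q m` forced `g k ≥ m`. Some `s` stronger than the limit decides `g k = j`. A long node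
of `s` lies in `q m` for `U`-almost all `m`, so for some `m > j`; by co-bigness `s` and that `q m`
are compatible (`QTwo.compatible_of_common_node`), a contradiction. So each pair and each `k` has a
bound that no condition below `p` with that pair can force `g k` to reach. Diagonalizing over the
pairs gives a ground-model `f` that `g` cannot be forced to dominate. -/

namespace CreatureParam

variable {c : CreatureParam}

theorem treeSuc_eq_image {η : List ℕ} (hη : η ∈ c.T) :
    treeSuc c.T η = (fun m : ℕ => η ++ [m]) '' Set.Iio (c.lam η) := by
  ext ν
  constructor
  · rintro ⟨h, m, rfl⟩
    exact ⟨m, (c.lam_spec η hη m).1 h, rfl⟩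
  · rintro ⟨m, hm, rfl⟩
    exact ⟨(c.lam_spec η hη m).2 hm, m, rfl⟩

theorem finite_treeSuc {η : List ℕ} (hη : η ∈ c.T) : (treeSuc c.T η).Finite := by
  rw [treeSuc_eq_image hη]
  exact (Set.finite_Iio _).image _

theorem ncard_treeSuc {η : List ℕ} (hη : η ∈ c.T) : (treeSuc c.T η).ncard = c.lam η := by
  rw [treeSuc_eq_image hη, Set.ncard_image_of_injective]
  · rw [Set.ncard_eq_toFinset_card']
    simp
  · intro a b h
    simpa using h

/-- A set of successors of norm at least one has at least two elements. -/
theorem exists_ne_of_one_le_nor {η : List ℕ} (hη : η ∈ c.T) {a : Set (List ℕ)}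
    (ha : a ⊆ treeSuc c.T η) (hne : a.Nonempty) (h : 1 ≤ c.nor η a) :
    ∃ x ∈ a, ∃ y ∈ a, x ≠ y := by
  have hhalf := c.half_lt η hη a ha hne h
  rw [ncard_treeSuc hη] at hhalf
  have hmu := c.mu_lt_lam η hη
  have hsq := c.sq_le_mu η hη
  have hlen : (0 : ℝ) ≤ η.length := Nat.cast_nonneg _
  -- Here `1 ≤ μ_η < λ_η`, so more than half of the successors means more than one.
  have hlam : (1 : ℝ) < c.lam η := by nlinarith
  have hlam2 : (2 : ℝ) ≤ c.lam η := by
    have : 1 < c.lam η := by exact_mod_cast hlam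
    exact_mod_cast this
  rw [lt_div_iff₀ (by linarith)] at hhalf
  have hcard : 1 < a.ncard := by
    have : (1 : ℝ) < a.ncard := by linarith
    exact_mod_cast this
  obtain ⟨x, y, hx, hy, hxy⟩ := (Set.one_lt_ncard_iff ((finite_treeSuc hη).subset ha)).1 hcard
  exact ⟨x, hx, y, hy, hxy⟩

end CreatureParam

theorem treeSuc_mono {S T : Set (List ℕ)} (h : S ⊆ T) (η : List ℕ) :
    treeSuc S η ⊆ treeSuc T η :=
  fun _ hν => ⟨h hν.1, hν.2⟩

theorem treeSuc_inter (S T : Set (List ℕ)) (η : List ℕ) :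
    treeSuc (S ∩ T) η = treeSuc S η ∩ treeSuc T η := by
  ext ν
  simp only [treeSuc, Set.mem_inter_iff, Set.mem_ofPred_eq]
  tauto

namespace QTwo

variable {c : CreatureParam}

/-- Distinct successors of one node are incomparable, so norm at least one makes every node from `η`
on split; nodes below `η` inherit the splitting at `η`. -/
theorem perfect_of_le_nor {η : List ℕ} {S : Set (List ℕ)} (hS : IsSubtree S) (hη : η ∈ S)
    (hsub : S ⊆ treeAbove c.T η)
    (hnor : ∀ ν ∈ S, η <+: ν → (treeSuc S ν).Nonempty ∧ 1 ≤ c.nor ν (treeSuc S ν)) :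
    IsPerfectTree S := by
  have key : ∀ ν ∈ S, η <+: ν → ∃ ν₁ ∈ S, ∃ ν₂ ∈ S,
      ν <+: ν₁ ∧ ν <+: ν₂ ∧ ¬ ν₁ <+: ν₂ ∧ ¬ ν₂ <+: ν₁ := by
    intro ν hν hpre
    obtain ⟨hne, h1⟩ := hnor ν hν hpre
    obtain ⟨x, ⟨hx, i, rfl⟩, y, ⟨hy, j, rfl⟩, hxy⟩ :=
      CreatureParam.exists_ne_of_one_le_nor (hsub hν).1
        (treeSuc_mono (fun _ h => (hsub h).1) ν) hne h1
    exact ⟨_, hx, _, hy, List.prefix_append _ _, List.prefix_append _ _,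
      fun h => hxy (h.eq_of_length (by simp)), fun h => hxy (h.eq_of_length (by simp)).symm⟩
  refine ⟨hS, fun ν hν => ?_⟩
  rcases (hsub hν).2 with h | h
  · obtain ⟨x, hx, y, hy, h1, h2, h3⟩ := key η hη (List.prefix_refl _)
    exact ⟨x, hx, y, hy, h.trans h1, h.trans h2, h3⟩
  · exact key ν hν h

/-- The condition with given trunk, tree and norm bound; perfectness is automatic. -/
def ofNor (η : List ℕ) (S : Set (List ℕ)) (n : ℕ) (hS : IsSubtree S) (hη : η ∈ S)
    (hsub : S ⊆ treeAbove c.T η) (h1 : 1 ≤ n) (hn : n ≤ η.length + 1)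
    (hnor : ∀ ν ∈ S, η <+: ν → (treeSuc S ν).Nonempty ∧
      1 + 1 / (n : ℝ) ≤ c.nor ν (treeSuc S ν)) : QTwo c where
  trunk := η
  tree := S
  n := n
  trunk_mem := hη
  perfect := perfect_of_le_nor hS hη hsub fun ν hν h =>
    ⟨(hnor ν hν h).1, le_trans (by simp) (hnor ν hν h).2⟩
  tree_subset := hsub
  one_le := h1
  n_le := hn
  le_nor := hnor

theorem tree_subset_T (p : QTwo c) : p.tree ⊆ c.T := fun _ h => (p.tree_subset h).1

theorem exists_long_node (p : QTwo c) (L : ℕ) :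
    ∃ ν ∈ p.tree, p.trunk <+: ν ∧ L ≤ ν.length := by
  induction L with
  | zero => exact ⟨p.trunk, p.trunk_mem, List.prefix_refl _, Nat.zero_le _⟩
  | succ L ih =>
    obtain ⟨ν, hν, hpre, hL⟩ := ih
    obtain ⟨_, hx, m, rfl⟩ := (p.le_nor ν hν hpre).1
    exact ⟨_, hx, hpre.trans (List.prefix_append _ _), by simpa using hL⟩

/-- Two conditions sharing a node above both trunks that is long compared with their norm bounds
are compatible. -/
theorem compatible_of_common_node (p q : QTwo c) {ν : List ℕ} (hp : ν ∈ p.tree)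
    (hq : ν ∈ q.tree) (htp : p.trunk <+: ν) (htq : q.trunk <+: ν) (hnp : p.n ≤ ν.length)
    (hnq : q.n ≤ ν.length) : ∃ r : QTwo c, p ≤ r ∧ q ≤ r := by
  have hlen : 1 ≤ ν.length := p.one_le.trans hnp
  have hnode : ∀ ρ ∈ (p.tree ∩ q.tree) ∩ treeAbove c.T ν, ν <+: ρ →
      (treeSuc ((p.tree ∩ q.tree) ∩ treeAbove c.T ν) ρ).Nonempty ∧
      1 + 1 / ((ν.length + 1 : ℕ) : ℝ) ≤
        c.nor ρ (treeSuc ((p.tree ∩ q.tree) ∩ treeAbove c.T ν) ρ) := by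
    rintro ρ ⟨⟨hρp, hρq⟩, hρ, -⟩ hνρ
    have heq : treeSuc ((p.tree ∩ q.tree) ∩ treeAbove c.T ν) ρ =
        ⋂ j : Fin 2, (![treeSuc p.tree ρ, treeSuc q.tree ρ] : Fin 2 → Set (List ℕ)) j := by
      rw [treeSuc_inter, treeSuc_inter]
      ext x
      simp only [Set.mem_inter_iff, Set.mem_iInter, Fin.forall_fin_two, Matrix.cons_val_zero,
        Matrix.cons_val_one]
      refine ⟨fun h => h.1, fun h => ⟨h, ?_⟩⟩
      obtain ⟨hx, m, rfl⟩ := h.1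
      exact ⟨⟨p.tree_subset_T hx, Or.inr (hνρ.trans (List.prefix_append _ _))⟩, m, rfl⟩
    have hL : (1 : ℝ) ≤ ν.length := by exact_mod_cast hlen
    have hLρ : (ν.length : ℝ) ≤ ρ.length := by exact_mod_cast hνρ.length_le
    have hmu : ((ν.length : ℝ) + 1) ^ 2 ≤ c.mu ρ :=
      le_trans (by gcongr) (c.sq_le_mu ρ hρ)
    -- With `L = ν.length`, intersecting two successor sets costs `1 / μ_ρ ≤ 1 / (L + 1)²`. The drop
    -- from `1 / L` to `1 / (L + 1)` pays for this, so `L + 1`, the largest norm bound allowed for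
    -- trunk `ν`, works.
    have hbound : ∀ n : ℕ, 1 ≤ n → n ≤ ν.length →
        1 + 1 / ((ν.length + 1 : ℕ) : ℝ) + 1 / c.mu ρ ≤ 1 + 1 / (n : ℝ) := by
      intro n h1 hn
      have h1' : (0 : ℝ) < n := by exact_mod_cast h1
      have hn' : (n : ℝ) ≤ ν.length := by exact_mod_cast hn
      have e1 : 1 / (ν.length : ℝ) ≤ 1 / n := one_div_le_one_div_of_le h1' hn'
      have e2 : 1 / c.mu ρ ≤ 1 / ((ν.length : ℝ) + 1) ^ 2 :=
        one_div_le_one_div_of_le (by positivity) hmu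
      have e3 : 1 / ((ν.length : ℝ) + 1) + 1 / ((ν.length : ℝ) + 1) ^ 2 ≤ 1 / (ν.length : ℝ) := by
        rw [div_add_div _ _ (by positivity) (by positivity),
          div_le_div_iff₀ (by positivity) (by positivity)]
        nlinarith
      push_cast
      linarith
    rw [heq]
    refine c.co_big ρ hρ _ (by positivity) 2 two_pos (by push_cast; nlinarith) _ ?_
    rw [Fin.forall_fin_two]
    have hp' := p.le_nor ρ hρp (htp.trans hνρ)
    have hq' := q.le_nor ρ hρq (htq.trans hνρ)
    exact ⟨⟨treeSuc_mono p.tree_subset_T ρ, hp'.1, (hbound _ p.one_le hnp).trans hp'.2⟩,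
      ⟨treeSuc_mono q.tree_subset_T ρ, hq'.1, (hbound _ q.one_le hnq).trans hq'.2⟩⟩
  have hmem : ν ∈ (p.tree ∩ q.tree) ∩ treeAbove c.T ν :=
    ⟨⟨hp, hq⟩, p.tree_subset_T hp, Or.inl (List.prefix_refl _)⟩
  have htree : IsSubtree ((p.tree ∩ q.tree) ∩ treeAbove c.T ν) := by
    refine ⟨⟨ν, hmem⟩, ?_⟩
    rintro η ρ hpre ⟨⟨h1, h2⟩, h3, h4⟩
    refine ⟨⟨p.perfect.1.2 _ _ hpre h1, q.perfect.1.2 _ _ hpre h2⟩, c.subtree.2 _ _ hpre h3, ?_⟩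
    rcases h4 with h4 | h4
    · exact Or.inl (hpre.trans h4)
    · exact List.prefix_or_prefix_of_prefix hpre h4
  exact ⟨ofNor ν _ (ν.length + 1) htree hmem Set.inter_subset_right (by omega) le_rfl hnode,
    fun _ h => h.1.1, fun _ h => h.1.2⟩

/-- Conditions with a common trunk and norm bound have a limit along any ultrafilter. -/
theorem exists_ultralimit (U : Ultrafilter ℕ) (p : ℕ → QTwo c) {η : List ℕ} {n : ℕ}
    (hη : ∀ m, (p m).trunk = η) (hn : ∀ m, (p m).n = n) :
    ∃ r : QTwo c, r.trunk = η ∧ r.n = n ∧ r.tree = {ν | ∀ᶠ m in U, ν ∈ (p m).tree} := by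
  have hmem : η ∈ {ν | ∀ᶠ m in U, ν ∈ (p m).tree} :=
    Filter.Eventually.of_forall fun m => hη m ▸ (p m).trunk_mem
  have hsub : {ν | ∀ᶠ m in U, ν ∈ (p m).tree} ⊆ treeAbove c.T η := by
    intro ν (hν : ∀ᶠ m in U, ν ∈ (p m).tree)
    obtain ⟨m, hm⟩ := hν.exists
    exact hη m ▸ (p m).tree_subset hm
  have htree : IsSubtree {ν | ∀ᶠ m in U, ν ∈ (p m).tree} :=
    ⟨⟨η, hmem⟩, fun ν ρ hpre (hρ : ∀ᶠ m in U, ρ ∈ (p m).tree) =>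
      hρ.mono fun m hm => (p m).perfect.1.2 _ _ hpre hm⟩
  have hsuc : ∀ ν ∈ c.T, ∀ᶠ m in U,
      treeSuc {ν | ∀ᶠ m in U, ν ∈ (p m).tree} ν = treeSuc (p m).tree ν := by
    intro ν hν
    -- An ultrafilter decides membership of each successor, and there are finitely many, so one
    -- large set of `m` handles all of them.
    have hall : ∀ᶠ m in U, ∀ x ∈ treeSuc c.T ν,
        ((∀ᶠ k in U, x ∈ (p k).tree) ↔ x ∈ (p m).tree) := by
      refine (Filter.eventually_all_finite (CreatureParam.finite_treeSuc hν)).2 fun x _ => ?_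
      by_cases hx : ∀ᶠ k in U, x ∈ (p k).tree
      · exact hx.mono fun m hm => ⟨fun _ => hm, fun _ => hx⟩
      · exact (Ultrafilter.eventually_not.2 hx).mono fun m hm =>
          ⟨fun h => absurd h hx, fun h => absurd h hm⟩
    refine hall.mono fun m hm => ?_
    ext x
    constructor
    · rintro ⟨hx, hs⟩
      exact ⟨(hm x ⟨(hsub hx).1, hs⟩).1 hx, hs⟩
    · rintro ⟨hx, hs⟩
      exact ⟨(hm x ⟨(p m).tree_subset_T hx, hs⟩).2 hx, hs⟩
  refine ⟨ofNor η _ n htree hmem hsub (hn 0 ▸ (p 0).one_le)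
    (by have := (p 0).n_le; rwa [hη, hn] at this) ?_, rfl, rfl, rfl⟩
  intro ν hν hpre
  obtain ⟨m, hm, hνm⟩ := ((hsuc ν (hsub hν).1).and hν).exists
  rw [hm]
  have := (p m).le_nor ν hνm (by rwa [hη])
  rwa [hn] at this

end QTwo

theorem Forcing.mem_of_le {P : Type*} [Preorder P] {g : Forcing.Name P} {n m : ℕ} {p q : P}
    (hpq : p ≤ q) (h : Forcing.mem g n m p) : Forcing.mem g n m q :=
  fun r hr => h r (hpq.trans hr)

/-- For a name `g` of a real, the conditions with a given trunk and norm bound cannot force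
arbitrarily large lower bounds on `g k`. -/
theorem QTwo.exists_not_forced_lower_bound {c : CreatureParam} {p : QTwo c}
    {g : Forcing.Name (QTwo c)} (hg : Forcing.isReal g p) (η : List ℕ) (n k : ℕ) :
    ∃ m : ℕ, ∀ r : QTwo c, p ≤ r → r.trunk = η → r.n = n →
      ¬ ∀ s, r ≤ s → ∀ j, Forcing.mem g k j s → m ≤ j := by
  by_contra! hcon
  choose q hpq hη hn hforce using hcon
  -- Nonprincipality is what makes `j < m` hold for `U`-almost all `m`.
  let U : Ultrafilter ℕ := Filter.hyperfilter ℕ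
  obtain ⟨r, hrη, -, hrtree⟩ := QTwo.exists_ultralimit U q hη hn
  have hpr : p ≤ r := by
    intro ν hν
    rw [hrtree] at hν
    obtain ⟨m, hm⟩ := Filter.Eventually.exists hν
    exact hpq m hm
  obtain ⟨s, hrs, j, hj⟩ := hg.1 k r hpr
  -- This length puts `ν` above `η` and makes it long enough for the norm bounds of both `s` and `q
  -- m`.
  obtain ⟨ν, hνs, hsν, hlen⟩ := s.exists_long_node (max (max s.n n) η.length)
  have hνr : ν ∈ r.tree := hrs hνs
  have hην : η <+: ν := by
    rcases (r.tree_subset hνr).2 with h | h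
    · rw [hrη] at h
      rw [h.eq_of_length (le_antisymm h.length_le (by omega))]
    · rwa [hrη] at h
  rw [hrtree] at hνr
  have hlarge : ∀ᶠ m in U, j < m := by
    have : ∀ᶠ m in (Filter.cofinite : Filter ℕ), j < m := by
      rw [Nat.cofinite_eq_atTop]
      exact Filter.eventually_gt_atTop j
    exact Filter.hyperfilter_le_cofinite this
  obtain ⟨m, hνm, hjm⟩ := (Filter.Eventually.and hνr hlarge).exists
  obtain ⟨t, hst, hqt⟩ := s.compatible_of_common_node (q m) hνs hνm hsν (by rwa [hη])
    (by omega) (by rw [hn]; omega)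
  exact absurd (hforce m t hqt j (Forcing.mem_of_le hst hj)) (by omega)

theorem claim6 (c : CreatureParam) : ¬ Forcing.AddsDominatingReal (QTwo c) := by
  rintro ⟨p, g, hg, hdom⟩
  choose B hB using fun e : List ℕ × ℕ => QTwo.exists_not_forced_lower_bound hg e.1 e.2
  -- `f k` exceeds the bounds for the first `k + 1` pairs of a trunk and a norm bound.
  let f : ℕ → ℕ := fun k => (Finset.range (k + 1)).sup fun i =>
    ((Encodable.decode i : Option (List ℕ × ℕ)).elim 0 fun e => B e k)
  obtain ⟨r, hpr, N, hN⟩ := hdom f p le_rfl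
  let e : List ℕ × ℕ := (r.trunk, r.n)
  -- Past `N` the domination applies at `k`, and `e` is among the pairs that `f k` takes into
  -- account.
  let k := max N (Encodable.encode e)
  refine hB e k r hpr rfl rfl fun s hrs j hj => ?_
  have hle : B e k ≤ f k := by
    have := Finset.le_sup (s := Finset.range (k + 1))
      (f := fun i => ((Encodable.decode i : Option (List ℕ × ℕ)).elim 0 fun e => B e k))
      (b := Encodable.encode e) (Finset.mem_range.2 (Nat.lt_succ_of_le (le_max_right _ _)))
    simp only [Encodable.encodek] at this
    exact this
  exact hle.trans (hN k j s hrs ⟨le_max_left _ _, hj⟩)
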